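/- Let $\mathbb B=\{0,1\}$, and let $\mathbb B^*$ and $\mathbb B^\infty$ be the sets of finite binary strings and of infinite binary sequences. Let $U$ be an optimal prefix machine: a partial computable function $U(p,y)$ of a program $p\in\mathbb B^*$ and an input $y\in\mathbb B^*$ such that for every $y$ no halting program is a proper prefix of another one, and such that for every other such machine $T$ there is a constant $c_T$ for which $T(p,y)=x$ always implies $U(q,y)=x$ for some $q$ with $\ell(q)\le \ell(p)+c_T$. Let $K(x|y)=\min\{\ell(p):U(p,y)=x\}$ be the conditional prefix Kolmogorov complexity, fix a constant $c\ge 0$, and put $d_K(x,y)=\max\{K(x|y),K(y|x)\}+c$ for $x\ne y$ and $d_K(x,x)=0$. Then for every $m$ and every bounded set $V\subseteq\mathbb R^m$, equipped with the metric $d(v,v')=\|v-v'\|_1$, both of the following hold. (String-embedding) There are functions $\phi_s:V\to\mathbb B^*$ ($s=1,2,\dots$) and constants $a,b$ such that $$\bigl|d_K(\phi_s(v),\phi_s(v'))-s\cdot\|v-v'\|_1\bigr|\le a\log_2 s+b\qquad\text{for all } s\ge 1\text{ and } v,v'\in V.$$ (Sequence-embedding) There are a function $\phi:V\to\mathbb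 B^\infty$, a function $f:\mathbb N\times V\to\mathbb N$ that is monotone increasing in $s$ and polynomially bounded in $s$ uniformly in $v$ (that is, $f(s,v)\le C s^k$ for some constants $C,k$ and all $s\ge1$, $v\in V$), and constants $a,b$ such that $$\bigl|d_K(\phi(v)_{1:f(s,v)},\phi(v')_{1:f(s,v')})-s\cdot\|v-v'\|_1\bigr|\le a\log_2 s+b\qquad\text{for all } s\ge 1\text{ and } v,v'\in V,$$ where $x_{1:n}$ denotes the string of the first $n$ bits of $x$. -/

import Mathlib

/-- A (conditional) prefix machine: a partial computable function `U(p, y)` of a program `p` and an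
input `y` such that, for each input `y`, no halting program is a proper prefix of another one. -/
structure IsPrefixMachine (U : List Bool → List Bool →. List Bool) : Prop where
  partrec : Partrec₂ U
  prefixFree : ∀ y p q : List Bool, (U p y).Dom → (U q y).Dom → p <+: q → p = q

/-- A prefix machine is optimal if it simulates every prefix machine with programs that are longer
by at most an additive constant (independent of program, input and output). Every universal prefix
Turing machine has this property. -/
structure IsOptimalPrefixMachine (U : List Bool → List Bool →. List Bool) : Prop
    extends IsPrefixMachine U where
  optimal : ∀ T : List Bool → List Bool →. List Bool, IsPrefixMachine T →
    ∃ c : ℕ, ∀ p y x : List Bool, x ∈ T p y → ∃ q : List Bool, x ∈ U q y ∧ q.length ≤ p.length + c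

/-- Conditional Kolmogorov complexity `K(x|y) = min {ℓ(p) : U(p, y) = x}`. -/
noncomputable def condK (U : List Bool → List Bool →. List Bool) (x y : List Bool) : ℕ :=
  sInf {n : ℕ | ∃ p : List Bool, x ∈ U p y ∧ p.length = n}

/-- For an optimal machine the minimum in `condK` is over a nonempty set, hence attained. -/
theorem IsOptimalPrefixMachine.exists_program {U : List Bool → List Bool →. List Bool}
    (hU : IsOptimalPrefixMachine U) (x y : List Bool) :
    ∃ p : List Bool, x ∈ U p y ∧ p.length = condK U x y := by
  have hT : IsPrefixMachine (fun p _ => (if p = [] then some x else none : Option (List Bool))) := by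
    refine ⟨?_, ?_⟩
    · have hc : Computable₂ (fun (p _ : List Bool) =>
          (if p = [] then some x else none : Option (List Bool))) := by
        have h : Primrec (fun a : List Bool × List Bool =>
            (if a.1 = [] then some x else none : Option (List Bool))) :=
          Primrec.ite (Primrec.eq.comp Primrec.fst (Primrec.const [])) (Primrec.const _)
            (Primrec.const _)
        exact h.to_comp
      exact Computable.ofOption hc
    · intro y p q hp hq _
      have key : ∀ r : List Bool,
          ((if r = [] then some x else none : Option (List Bool)) : Part (List Bool)).Dom →
            r = [] := by
        intro r hr
        by_contra hne
        simp [hne] at hr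
      rw [key p hp, key q hq]
  obtain ⟨c, hc⟩ := hU.optimal _ hT
  obtain ⟨q, hq, -⟩ := hc [] y x (by simp)
  exact Nat.sInf_mem (s := {n : ℕ | ∃ p : List Bool, x ∈ U p y ∧ p.length = n}) ⟨_, q, hq, rfl⟩

/-- The complexity distance `d_K` on binary strings, with additive constant `c`:
`d_K(x, y) = max {K(x|y), K(y|x)} + c` if `x ≠ y`, and `d_K(x, x) = 0`. -/
noncomputable def complexityDist (U : List Bool → List Bool →. List Bool) (c : ℝ)
    (x y : List Bool) : ℝ :=
  if x = y then 0 else max (condK U x y : ℝ) (condK U y x : ℝ) + c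

/-- `φ_s : V → {0,1}^*`, `s = 1, 2, …`, is a string-embedding of the metric space `V` into binary
strings with distance `d`: `d(φ_s(v), φ_s(v')) = s · dist(v, v') ± (a log s + b)`, where `a` and `b`
do not depend on `s`, `v`, `v'`. -/
def IsStringEmbedding {V : Type*} [MetricSpace V] (d : List Bool → List Bool → ℝ)
    (φ : ℕ → V → List Bool) : Prop :=
  ∃ a b : ℝ, ∀ s : ℕ, 1 ≤ s → ∀ v v' : V,
    |d (φ s v) (φ s v') - s * dist v v'| ≤ a * Real.logb 2 s + b

/-- The string formed by the first `n` bits of an infinite binary sequence. -/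
def initialSegment (x : ℕ → Bool) (n : ℕ) : List Bool := (List.range n).map x

/-- `φ : V → {0,1}^∞` is a sequence-embedding of the metric space `V` into binary strings with
distance `d`: for some prefix lengths `f(s, v)`, monotone in `s` and growing at most polynomially
in `s`, the prefixes `φ(v)_{1:f(s,v)}` form a string-embedding. -/
def IsSequenceEmbedding {V : Type*} [MetricSpace V] (d : List Bool → List Bool → ℝ)
    (φ : V → ℕ → Bool) : Prop :=
  ∃ f : ℕ → V → ℕ, (∀ v : V, Monotone fun s => f s v) ∧
    (∃ C k : ℕ, ∀ s : ℕ, 1 ≤ s → ∀ v : V, f s v ≤ C * s ^ k) ∧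
    IsStringEmbedding d fun s v => initialSegment (φ v) (f s v)

/-!
After an affine change of coordinates `V` lies in the unit cube, and `s` is replaced by a multiple
`n` of `s`. Take two infinite sequences `A i` and `B i` of fair coins for each coordinate `i < m`.
A point `w` of the cube is sent to an interleaving of all these sequences: in each round, coordinate
`i` contributes the next coin of either `A i` or `B i`, in such a way that after `n` rounds
`⌊w i * n⌋` coins of `A i` and `n - ⌊w i * n⌋` coins of `B i` are used. The coins used up to round
`n` for `w` but not for `w'` number `∑ i, |⌊w i * n⌋ - ⌊w' i * n⌋|`, which is `n ‖w - w'‖₁` up to an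
error of at most `m` (`abs_card_coinIndices_sdiff_sub_le`); this number is symmetric in `w` and
`w'`. It remains to see that it is the conditional complexity of the two prefixes up to `O(log n)`.

Upper bound: up to round `n` the order of interleaving of `w` is also that of a vector of fractions
with numerators and denominators at most `n`, namely the largest such fractions below the `w i`
(`exists_slopeCode`). Hence `O(log n)` bits describe the orders of interleaving of `w` and `w'`. A
program consisting of a self-delimiting code of these fractions and the new coins computes one
prefix from the other (`IsOptimalPrefixMachine.exists_condK_coins_le_log_encode`).

Lower bound: for fixed orders of interleaving, counting programs shows that the new coins can be
compressed by `t` bits, given the other prefix, with probability at most `2⁻ᵗ`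
(`coinMeasure_compressible_le`). As there are polynomially many orders of interleaving up to round
`n`, the Borel-Cantelli lemma with `t` a large multiple of `log n` yields coins which are almost
incompressible for all large `n` and all pairs of points at once
(`ae_eventually_coins_incompressible`).
-/

open MeasureTheory
open scoped ENNReal

/-! ### Self-delimiting headers -/

/-- The number whose binary digits, least significant first, are `b`. -/
def bitsValue (b : List Bool) : ℕ := b.foldr (fun x n => 2 * n + cond x 1 0) 0

theorem primrec_bitsValue : Primrec bitsValue := by
  have h : Primrec fun a : List Bool × Bool × ℕ => 2 * a.2.2 + cond a.2.1 1 0 :=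
    Primrec.nat_add.comp
      (Primrec.nat_mul.comp (Primrec.const 2) (Primrec.snd.comp Primrec.snd))
      (Primrec.cond (Primrec.fst.comp Primrec.snd) (Primrec.const 1) (Primrec.const 0))
  exact Primrec.list_foldr Primrec.id (Primrec.const 0) h.to₂

theorem exists_bitsValue_eq (l e : ℕ) (he : e < 2 ^ l) :
    ∃ b : List Bool, b.length = l ∧ bitsValue b = e := by
  induction l generalizing e with
  | zero => exact ⟨[], rfl, by simp at he; simp [bitsValue, he]⟩
  | succ l ih =>
    obtain ⟨b, hb, hv⟩ := ih (e / 2) (by rw [pow_succ] at he; omega)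
    refine ⟨(e % 2 == 1) :: b, by simp [hb], ?_⟩
    have : bitsValue ((e % 2 == 1) :: b) = 2 * bitsValue b + cond (e % 2 == 1) 1 0 := rfl
    rw [this, hv]
    rcases Nat.mod_two_eq_zero_or_one e with h | h <;> simp [h] <;> omega

/-- The length of the unary part `1 ⋯ 1` of a program `1 ⋯ 1 0 b z`, where `b` is as long as the
unary part. -/
def headerLength (p : List Bool) : ℕ := p.idxOf false

/-- The number coded by `b` in a program `1 ⋯ 1 0 b z`. -/
def headerValue (p : List Bool) : ℕ :=
  bitsValue ((p.drop (headerLength p + 1)).take (headerLength p))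

/-- The machine which reads a program `1 ⋯ 1 0 b z`, decodes `b` to a number `e`, checks that `z`
has length `len e y` and outputs `out e z y`. -/
def headerMachine (out : ℕ → List Bool → List Bool → List Bool) (len : ℕ → List Bool → ℕ)
    (p y : List Bool) : Option (List Bool) :=
  if p.length = 2 * headerLength p + 1 + len (headerValue p) y then
    some (out (headerValue p) (p.drop (2 * headerLength p + 1)) y) else none

theorem isPrefixMachine_headerMachine {out : ℕ → List Bool → List Bool → List Bool}
    {len : ℕ → List Bool → ℕ}
    (hout : Primrec fun a : ℕ × List Bool × List Bool => out a.1 a.2.1 a.2.2)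
    (hlen : Primrec₂ len) :
    IsPrefixMachine fun p y => (headerMachine out len p y : Part (List Bool)) := by
  constructor
  · have hl : Primrec fun a : List Bool × List Bool => headerLength a.1 :=
      Primrec.list_idxOf.comp (Primrec.const false) Primrec.fst
    have hv : Primrec fun a : List Bool × List Bool => headerValue a.1 :=
      primrec_bitsValue.comp (Primrec.list_take.comp hl
        (Primrec.list_drop.comp (Primrec.succ.comp hl) Primrec.fst))
    have h2 : Primrec fun a : List Bool × List Bool => 2 * headerLength a.1 + 1 :=
      Primrec.succ.comp (Primrec.nat_mul.comp (Primrec.const 2) hl)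
    have h : Primrec fun a : List Bool × List Bool => headerMachine out len a.1 a.2 :=
      Primrec.ite
        (Primrec.eq.comp (Primrec.list_length.comp Primrec.fst)
          (Primrec.nat_add.comp h2 (hlen.comp hv Primrec.snd)))
        (Primrec.option_some.comp (hout.comp (hv.pair
          ((Primrec.list_drop.comp h2 Primrec.fst).pair Primrec.snd))))
        (Primrec.const none)
    exact Computable.ofOption h.to_comp
  · have key : ∀ r y : List Bool, (headerMachine out len r y : Part (List Bool)).Dom →
        r.length = 2 * headerLength r + 1 + len (headerValue r) y := by
      intro r y hr
      by_contra hne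
      simp [headerMachine, hne] at hr
    rintro y p q hp hq ⟨z, rfl⟩
    have h1 := key _ _ hp
    have h2 := key _ _ hq
    have hmem : false ∈ p := by
      rw [← List.idxOf_lt_length_iff]
      change headerLength p < _
      omega
    have hl : headerLength (p ++ z) = headerLength p := List.idxOf_append_of_mem hmem
    have hv : headerValue (p ++ z) = headerValue p := by
      unfold headerValue
      rw [hl, List.drop_append_of_le_length (by omega),
        List.take_append_of_le_length (by simp; omega)]
    rw [hl, hv, ← h1, List.length_append] at h2
    have : z = [] := List.length_eq_zero_iff.1 (by omega)
    simp [this]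

theorem headerMachine_apply {out : ℕ → List Bool → List Bool → List Bool}
    {len : ℕ → List Bool → ℕ} {b z y : List Bool} (hz : z.length = len (bitsValue b) y) :
    headerMachine out len (List.replicate b.length true ++ false :: (b ++ z)) y =
      some (out (bitsValue b) z y) := by
  have hl : headerLength (List.replicate b.length true ++ false :: (b ++ z)) = b.length := by
    unfold headerLength
    rw [List.idxOf_append_of_notMem (by simp [List.mem_replicate])]
    simp
  have hd : (List.replicate b.length true ++ false :: (b ++ z)).drop (b.length + 1) = b ++ z := by
    rw [List.drop_append]
    simp
  have hv : headerValue (List.replicate b.length true ++ false :: (b ++ z)) = bitsValue b := by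
    unfold headerValue
    rw [hl, hd]
    simp
  have hd2 : (List.replicate b.length true ++ false :: (b ++ z)).drop (2 * b.length + 1) = z := by
    rw [show 2 * b.length + 1 = (b.length + 1) + b.length by ring, ← List.drop_drop, hd]
    simp
  unfold headerMachine
  rw [hl, hv, hd2, if_pos]
  simp [hz]
  ring

/-- Upper bounds on conditional complexity come from a computable description: if `x` is computed
from `y`, a number `e` and exactly `len e y` further bits, then `K(x | y)` exceeds `len e y` by at
most twice the binary length of `e`, up to a constant. -/
theorem IsOptimalPrefixMachine.condK_le_of_primrec {U : List Bool → List Bool →. List Bool}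
    (hU : IsOptimalPrefixMachine U) {out : ℕ → List Bool → List Bool → List Bool}
    {len : ℕ → List Bool → ℕ}
    (hout : Primrec fun a : ℕ × List Bool × List Bool => out a.1 a.2.1 a.2.2)
    (hlen : Primrec₂ len) :
    ∃ c : ℕ, ∀ (e : ℕ) (z y : List Bool), z.length = len e y →
      condK U (out e z y) y ≤ len e y + 2 * Nat.log 2 e + c := by
  obtain ⟨c, hc⟩ := hU.optimal _ (isPrefixMachine_headerMachine hout hlen)
  refine ⟨c + 3, fun e z y hz => ?_⟩
  obtain ⟨b, hb, rfl⟩ := exists_bitsValue_eq (Nat.log 2 e + 1) e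
    (Nat.lt_pow_succ_log_self one_lt_two e)
  obtain ⟨q, hq, hql⟩ := hc (List.replicate b.length true ++ false :: (b ++ z)) y
    (out (bitsValue b) z y) (by rw [headerMachine_apply hz]; simp)
  have h1 : condK U (out (bitsValue b) z y) y ≤ q.length := Nat.sInf_le ⟨q, hq, rfl⟩
  simp only [List.length_append, List.length_replicate, List.length_cons] at hql
  omega

/-- Together with the lower bound this shows that the points of two equal strings are close, as
needed where `complexityDist` is `0`. -/
theorem IsOptimalPrefixMachine.condK_self_le {U : List Bool → List Bool →. List Bool}
    (hU : IsOptimalPrefixMachine U) : ∃ c : ℕ, ∀ x : List Bool, condK U x x ≤ c := by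
  obtain ⟨c, hc⟩ := hU.condK_le_of_primrec (out := fun _ _ y => y) (len := fun _ _ => 0)
    (Primrec.snd.comp Primrec.snd) (Primrec.const 0)
  exact ⟨c, fun x => by simpa using hc 0 [] x rfl⟩

/-! ### Interleavings of coin sequences along staircases -/

/-- A staircase: a function on `ℕ` which starts at `0` and whose increments are `0` or `1`. -/
structure IsStaircase (h : ℕ → ℕ) : Prop where
  zero : h 0 = 0
  le_succ : ∀ r, h r ≤ h (r + 1)
  succ_le : ∀ r, h (r + 1) ≤ h r + 1

theorem IsStaircase.le_self {h : ℕ → ℕ} (hh : IsStaircase h) (n : ℕ) : h n ≤ n := by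
  induction n with
  | zero => exact hh.zero.le
  | succ n ih => have := hh.succ_le n; omega

theorem IsStaircase.sub_self {h : ℕ → ℕ} (hh : IsStaircase h) : IsStaircase fun r => r - h r where
  zero := by simp
  le_succ r := by have := hh.succ_le r; omega
  succ_le r := by have := hh.le_succ r; omega

theorem IsStaircase.exists_step {h : ℕ → ℕ} (hh : IsStaircase h) {a n : ℕ} (ha : a < h n) :
    ∃ r < n, h r = a ∧ h (r + 1) = a + 1 := by
  induction n with
  | zero => rw [hh.zero] at ha; omega
  | succ n ih =>
    by_cases hn : a < h n
    · obtain ⟨r, hr, h'⟩ := ih hn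
      exact ⟨r, by omega, h'⟩
    · have := hh.succ_le n
      exact ⟨n, by omega, by omega, by omega⟩

/-- The random source consists of `2 m` streams of coins: the index `(i, true, a)` refers to coin
`a` of the first stream, and `(i, false, a)` to coin `a` of the second stream, for the coordinate
`i < m`. The `m` coordinates are served in turn, and in its round `r` coordinate `i` uses the next
coin of its first stream if the staircase `h i` steps up at `r`, and that of its second stream
otherwise. This is the index of the coin used at time `t`. -/
def coinIndex (m : ℕ) (h : ℕ → ℕ → ℕ) (t : ℕ) : ℕ × Bool × ℕ :=
  if h (t % m) (t / m + 1) = h (t % m) (t / m) then (t % m, false, t / m - h (t % m) (t / m))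
  else (t % m, true, h (t % m) (t / m))

/-- The indices of the first `N` coins used. -/
def coinIndices (m : ℕ) (h : ℕ → ℕ → ℕ) (N : ℕ) : List (ℕ × Bool × ℕ) :=
  (List.range N).map (coinIndex m h)

@[simp]
theorem length_coinIndices (m : ℕ) (h : ℕ → ℕ → ℕ) (N : ℕ) : (coinIndices m h N).length = N := by
  simp [coinIndices]

theorem coinIndices_congr {m n : ℕ} {h h' : ℕ → ℕ → ℕ}
    (hh : ∀ i < m, ∀ r ≤ n, h i r = h' i r) :
    coinIndices m h (m * n) = coinIndices m h' (m * n) := by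
  refine List.map_congr_left fun t ht => ?_
  rw [List.mem_range] at ht
  have hm : 0 < m := Nat.pos_of_ne_zero (by rintro rfl; simp at ht)
  have hi := Nat.mod_lt t hm
  have hr : t / m < n := Nat.div_lt_of_lt_mul ht
  unfold coinIndex
  rw [hh _ hi _ hr.le, hh _ hi _ hr]

/-- The indices of the first `f i` coins of the first stream and of the first `g i` coins of the
second stream of each coordinate `i < m`. -/
def initialCoins (m : ℕ) (f g : ℕ → ℕ) : Finset (ℕ × Bool × ℕ) :=
  (Finset.range m).biUnion fun i =>
    (Finset.range (f i)).image (fun a => (i, true, a)) ∪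
      (Finset.range (g i)).image (fun a => (i, false, a))

theorem mem_initialCoins {m : ℕ} {f g : ℕ → ℕ} {e : ℕ × Bool × ℕ} :
    e ∈ initialCoins m f g ↔ e.1 < m ∧ e.2.2 < cond e.2.1 (f e.1) (g e.1) := by
  obtain ⟨i, b, a⟩ := e
  cases b <;> simp [initialCoins]

theorem card_initialCoins (m : ℕ) (f g : ℕ → ℕ) :
    (initialCoins m f g).card = ∑ i ∈ Finset.range m, (f i + g i) := by
  unfold initialCoins
  rw [Finset.card_biUnion]
  · refine Finset.sum_congr rfl fun i _ => ?_
    rw [Finset.card_union_of_disjoint, Finset.card_image_of_injective,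
      Finset.card_image_of_injective, Finset.card_range, Finset.card_range]
    · intro a b; simp
    · intro a b; simp
    · simp [Finset.disjoint_left]
  · intro i _ j _ hij
    rw [Function.onFun, Finset.disjoint_left]
    rintro ⟨k, b, a⟩ h1 h2
    simp only [Finset.mem_union, Finset.mem_image, Prod.mk.injEq] at h1 h2
    obtain ⟨_, _, h1, -⟩ | ⟨_, _, h1, -⟩ := h1 <;> obtain ⟨_, _, h2, -⟩ | ⟨_, _, h2, -⟩ := h2 <;>
      exact hij (h1.trans h2.symm)

theorem initialCoins_inter (m : ℕ) (f g f' g' : ℕ → ℕ) :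
    initialCoins m f g ∩ initialCoins m f' g' =
      initialCoins m (fun i => min (f i) (f' i)) fun i => min (g i) (g' i) := by
  ext ⟨i, b, a⟩
  simp only [Finset.mem_inter, mem_initialCoins]
  cases b <;> simp <;> tauto

/-- The indices of the coins used in `n` rounds along staircases with values `h i` at `n`. -/
def usedCoins (m n : ℕ) (h : ℕ → ℕ) : Finset (ℕ × Bool × ℕ) :=
  initialCoins m h fun i => n - h i

theorem card_usedCoins {m n : ℕ} {h : ℕ → ℕ} (hn : ∀ i < m, h i ≤ n) :
    (usedCoins m n h).card = m * n := by
  unfold usedCoins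
  rw [card_initialCoins, Finset.sum_congr rfl (g := fun _ => n)]
  · simp
  · intro i hi
    have := hn i (Finset.mem_range.1 hi)
    omega

theorem card_usedCoins_sdiff {m n : ℕ} {h h' : ℕ → ℕ} (hn : ∀ i < m, h i ≤ n)
    (hn' : ∀ i < m, h' i ≤ n) :
    (usedCoins m n h \ usedCoins m n h').card =
      ∑ i ∈ Finset.range m, ((h i - h' i) + (h' i - h i)) := by
  have h1 := Finset.card_sdiff_add_card_inter (usedCoins m n h) (usedCoins m n h')
  rw [card_usedCoins hn, usedCoins, usedCoins, initialCoins_inter, card_initialCoins] at h1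
  have h2 : ∑ i ∈ Finset.range m, ((h i - h' i) + (h' i - h i)) +
      ∑ i ∈ Finset.range m, (min (h i) (h' i) + min (n - h i) (n - h' i)) = m * n := by
    rw [← Finset.sum_add_distrib, Finset.sum_congr rfl (g := fun _ => n)]
    · simp
    · intro i hi
      have := hn i (Finset.mem_range.1 hi)
      have := hn' i (Finset.mem_range.1 hi)
      omega
  unfold usedCoins
  omega

/-- The first `m n` coins used along a staircase are pairwise distinct and form an initial part of
each stream. -/
theorem toFinset_coinIndices {m n : ℕ} {h : ℕ → ℕ → ℕ} (hh : ∀ i < m, IsStaircase (h i)) :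
    (coinIndices m h (m * n)).toFinset = usedCoins m n fun i => h i n := by
  symm
  -- The list has as many entries as the set has elements, so that one inclusion suffices.
  refine Finset.eq_of_subset_of_card_le ?_ ?_
  · rintro ⟨i, b, a⟩ he
    obtain ⟨hi, ha⟩ := mem_initialCoins.1 he
    have key : ∀ r < n, coinIndex m h (i + m * r) = (i, b, a) →
        (i, b, a) ∈ (coinIndices m h (m * n)).toFinset := by
      intro r hr he
      simp only [coinIndices, List.mem_toFinset, List.mem_map, List.mem_range]
      refine ⟨i + m * r, ?_, he⟩
      calc i + m * r < m + m * r := by simp only [] at hi; omega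
        _ = m * (r + 1) := by ring
        _ ≤ m * n := Nat.mul_le_mul_left _ hr
    have hm : ∀ r, (i + m * r) % m = i := fun r => by
      rw [Nat.add_mul_mod_self_left, Nat.mod_eq_of_lt hi]
    have hd : ∀ r, (i + m * r) / m = r := fun r => by
      rw [Nat.add_mul_div_left _ _ (by simp only [] at hi; omega), Nat.div_eq_of_lt hi, zero_add]
    cases b
    · obtain ⟨r, hr, h1, h2⟩ := (hh i hi).sub_self.exists_step ha
      refine key r hr ?_
      have h3 := (hh i hi).le_succ r
      have h4 := (hh i hi).succ_le r
      simp only [coinIndex, hm, hd]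
      rw [if_pos (by omega), h1]
    · obtain ⟨r, hr, h1, h2⟩ := (hh i hi).exists_step ha
      refine key r hr ?_
      simp only [coinIndex, hm, hd]
      rw [if_neg (by omega), h1]
  · rw [card_usedCoins fun i hi => (hh i hi).le_self n]
    exact (List.toFinset_card_le _).trans (by simp)

theorem nodup_coinIndices {m n : ℕ} {h : ℕ → ℕ → ℕ} (hh : ∀ i < m, IsStaircase (h i)) :
    (coinIndices m h (m * n)).Nodup := by
  rw [← Multiset.coe_nodup, ← Multiset.toFinset_card_eq_card_iff_nodup]
  change (coinIndices m h (m * n)).toFinset.card = (coinIndices m h (m * n)).length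
  rw [toFinset_coinIndices hh, card_usedCoins fun i hi => (hh i hi).le_self n, length_coinIndices]

/-- The number of coins used along one staircase and not along another one. -/
theorem card_coinIndices_sdiff {m n : ℕ} {h h' : ℕ → ℕ → ℕ} (hh : ∀ i < m, IsStaircase (h i))
    (hh' : ∀ i < m, IsStaircase (h' i)) :
    ((coinIndices m h (m * n)).toFinset \ (coinIndices m h' (m * n)).toFinset).card =
      ∑ i ∈ Finset.range m, ((h i n - h' i n) + (h' i n - h i n)) := by
  rw [toFinset_coinIndices hh, toFinset_coinIndices hh',
    card_usedCoins_sdiff (fun i hi => (hh i hi).le_self n) fun i hi => (hh' i hi).le_self n]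

/-! ### Staircases of given slope -/

/-- The staircases `r ↦ ⌊w i * r⌋`. -/
noncomputable def slopeStair (w : ℕ → ℝ) (i r : ℕ) : ℕ := ⌊w i * r⌋₊

theorem isStaircase_slopeStair {w : ℕ → ℝ} {i : ℕ} (h0 : 0 ≤ w i) (h1 : w i ≤ 1) :
    IsStaircase (slopeStair w i) where
  zero := by simp [slopeStair]
  le_succ r := Nat.floor_mono (by push_cast; nlinarith)
  succ_le r := by
    unfold slopeStair
    have h2 : 0 ≤ w i * r := by positivity
    rw [← Nat.floor_add_one h2]
    exact Nat.floor_mono (by push_cast; nlinarith)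

theorem abs_floor_sub_floor_sub_le {x y : ℝ} (hx : 0 ≤ x) (hy : 0 ≤ y) :
    abs ((((⌊x⌋₊ - ⌊y⌋₊) + (⌊y⌋₊ - ⌊x⌋₊) : ℕ) : ℝ) - |x - y|) ≤ 1 := by
  have h1 := Nat.floor_le hx
  have h2 := Nat.floor_le hy
  have h3 := Nat.lt_floor_add_one x
  have h4 := Nat.lt_floor_add_one y
  have h5 : (((⌊x⌋₊ - ⌊y⌋₊) + (⌊y⌋₊ - ⌊x⌋₊) : ℕ) : ℝ) = |(⌊x⌋₊ : ℝ) - ⌊y⌋₊| := by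
    rcases le_total ⌊x⌋₊ ⌊y⌋₊ with h | h
    · have h' : (⌊x⌋₊ : ℝ) ≤ ⌊y⌋₊ := by exact_mod_cast h
      rw [abs_of_nonpos (by linarith), Nat.sub_eq_zero_of_le h, zero_add, Nat.cast_sub h]
      ring
    · have h' : (⌊y⌋₊ : ℝ) ≤ ⌊x⌋₊ := by exact_mod_cast h
      rw [abs_of_nonneg (by linarith), Nat.sub_eq_zero_of_le h, add_zero, Nat.cast_sub h]
  rw [h5]
  refine (abs_abs_sub_abs_le _ _).trans ?_
  rw [abs_le]
  constructor <;> linarith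

/-- Up to the horizon `n`, the staircase of slope `u ∈ [0, 1]` is that of a fraction with numerator
and denominator at most `n`. -/
theorem exists_fraction_floor_eq {u : ℝ} (h0 : 0 ≤ u) (h1 : u ≤ 1) {n : ℕ} (hn : 1 ≤ n) :
    ∃ p q : ℕ, p ≤ n ∧ q ≤ n ∧ ∀ r ≤ n, ⌊u * r⌋₊ = p * r / q := by
  classical
  -- The largest fraction with denominator at most `n` that does not exceed `u`.
  obtain ⟨⟨p, q⟩, hpq, hmax⟩ := Finset.exists_max_image
    ((Finset.range (n + 1) ×ˢ Finset.Icc 1 n).filter fun a : ℕ × ℕ => (a.1 : ℝ) / a.2 ≤ u)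
    (fun a => (a.1 : ℝ) / a.2) ⟨(0, 1), by simp [hn, h0]⟩
  simp only [Finset.mem_filter, Finset.mem_product, Finset.mem_range, Finset.mem_Icc] at hpq hmax
  obtain ⟨⟨hp, hq1, hq⟩, hle⟩ := hpq
  have hq0 : (0 : ℝ) < q := by exact_mod_cast hq1
  refine ⟨p, q, by omega, hq, fun r hr => le_antisymm ?_ ?_⟩
  · rcases Nat.eq_zero_or_pos r with rfl | hr0
    · simp
    have hr0' : (0 : ℝ) < r := by exact_mod_cast hr0
    have hf : (⌊u * r⌋₊ : ℝ) ≤ u * r := Nat.floor_le (by positivity)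
    have hfr : ⌊u * r⌋₊ ≤ r := by
      have : (⌊u * r⌋₊ : ℝ) ≤ r := hf.trans (by nlinarith)
      exact_mod_cast this
    have := hmax (⌊u * r⌋₊, r) ⟨⟨by dsimp; omega, hr0, hr⟩, by rwa [div_le_iff₀ hr0']⟩
    rw [div_le_div_iff₀ hr0' hq0] at this
    rw [Nat.le_div_iff_mul_le hq1]
    exact_mod_cast this
  · refine Nat.le_floor ?_
    calc ((p * r / q : ℕ) : ℝ) ≤ ((p * r : ℕ) : ℝ) / q := Nat.cast_div_le
      _ = (p : ℝ) / q * r := by push_cast; ring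
      _ ≤ u * r := by gcongr

/-- The staircases of the slopes listed in `L` as pairs of numerator and denominator. Missing
entries and denominators `0` give the slope `0`. -/
def fractionStair (L : List (ℕ × ℕ)) (i r : ℕ) : ℕ := (L.getI i).1 * r / (L.getI i).2

/-- Lists of `m` pairs of numbers up to `n`, read as slopes by `fractionStair`. They include codes
of slopes above `1`, which do no harm as only their number matters. -/
def slopeCodes (m n : ℕ) : Set (List (ℕ × ℕ)) :=
  Set.range fun c : Fin m → Fin (n + 1) × Fin (n + 1) =>
    List.ofFn fun i => ((c i).1.val, (c i).2.val)

theorem exists_slopeCode {m n : ℕ} {w : ℕ → ℝ} (h0 : ∀ i, 0 ≤ w i) (h1 : ∀ i, w i ≤ 1)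
    (hn : 1 ≤ n) :
    ∃ L ∈ slopeCodes m n,
      coinIndices m (fractionStair L) (m * n) = coinIndices m (slopeStair w) (m * n) := by
  choose p q hp hq hpq using fun i => exists_fraction_floor_eq (h0 i) (h1 i) hn
  refine ⟨_, ⟨fun i => (⟨p i, Nat.lt_succ_of_le (hp i)⟩, ⟨q i, Nat.lt_succ_of_le (hq i)⟩), rfl⟩,
    coinIndices_congr fun i hi r hr => ?_⟩
  rw [slopeStair, hpq i r hr, fractionStair, List.getI_eq_getElem _ (by simpa using hi)]
  simp

/-! ### The upper bound -/

theorem primrec_fractionStair :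
    Primrec fun a : List (ℕ × ℕ) × ℕ × ℕ => fractionStair a.1 a.2.1 a.2.2 := by
  have h : Primrec fun a : List (ℕ × ℕ) × ℕ × ℕ => a.1.getI a.2.1 :=
    Primrec.list_getI.comp Primrec.fst (Primrec.fst.comp Primrec.snd)
  exact Primrec.nat_div.comp
    (Primrec.nat_mul.comp (Primrec.fst.comp h) (Primrec.snd.comp Primrec.snd)) (Primrec.snd.comp h)

theorem primrec_coinIndices (m : ℕ) :
    Primrec₂ fun (L : List (ℕ × ℕ)) (N : ℕ) => coinIndices m (fractionStair L) N := by
  have hi : Primrec fun a : List (ℕ × ℕ) × ℕ => a.2 % m :=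
    Primrec.nat_mod.comp Primrec.snd (Primrec.const m)
  have hr : Primrec fun a : List (ℕ × ℕ) × ℕ => a.2 / m :=
    Primrec.nat_div.comp Primrec.snd (Primrec.const m)
  have h0 : Primrec fun a : List (ℕ × ℕ) × ℕ => fractionStair a.1 (a.2 % m) (a.2 / m) :=
    primrec_fractionStair.comp (Primrec.fst.pair (hi.pair hr))
  have h1 : Primrec fun a : List (ℕ × ℕ) × ℕ => fractionStair a.1 (a.2 % m) (a.2 / m + 1) :=
    primrec_fractionStair.comp (Primrec.fst.pair (hi.pair (Primrec.succ.comp hr)))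
  have h : Primrec₂ fun (L : List (ℕ × ℕ)) (t : ℕ) => coinIndex m (fractionStair L) t :=
    Primrec.ite (Primrec.eq.comp h1 h0)
      (hi.pair ((Primrec.const false).pair (Primrec.nat_sub.comp hr h0)))
      (hi.pair ((Primrec.const true).pair h0))
  exact Primrec.list_map (Primrec.list_range.comp Primrec.snd)
    (h.comp (Primrec.fst.comp Primrec.fst) Primrec.snd).to₂

/-- The entries of `G` which do not occur in `G'`. -/
def newEntries (G G' : List (ℕ × Bool × ℕ)) : List (ℕ × Bool × ℕ) := G.filter fun e => e ∉ G'

/-- The values along `G`, looked up in the values `y` along `G'` and the values `z` along the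
entries of `G` which do not occur in `G'`. -/
def lookupValues (G G' : List (ℕ × Bool × ℕ)) (z y : List Bool) : List Bool :=
  G.map fun e => (y ++ z).getI ((G' ++ newEntries G G').idxOf e)

theorem lookupValues_map (G G' : List (ℕ × Bool × ℕ)) (ω : ℕ × Bool × ℕ → Bool) :
    lookupValues G G' ((newEntries G G').map ω) (G'.map ω) = G.map ω := by
  refine List.map_congr_left fun e he => ?_
  have hmem : e ∈ G' ++ newEntries G G' := by
    by_cases h : e ∈ G' <;> simp [newEntries, h, he]
  have hlt := List.idxOf_lt_length_of_mem hmem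
  rw [← List.map_append, List.getI_eq_getElem _ (by simpa using hlt), List.getElem_map,
    List.getElem_idxOf]

theorem length_newEntries {G G' : List (ℕ × Bool × ℕ)} (hG : G.Nodup) :
    (newEntries G G').length = (G.toFinset \ G'.toFinset).card := by
  rw [newEntries, ← List.toFinset_card_of_nodup (hG.filter _)]
  congr 1
  ext e
  simp

theorem primrec_idxOf_coins : Primrec₂ fun (e : ℕ × Bool × ℕ) l => List.idxOf e l := by
  convert Primrec.list_idxOf (α := ℕ × Bool × ℕ) using 4

theorem primrec_newEntries : Primrec₂ newEntries := by
  have hm : PrimrecPred fun a : (List (ℕ × Bool × ℕ) × List (ℕ × Bool × ℕ)) × ℕ × Bool × ℕ =>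
      a.1.2.idxOf a.2 < a.1.2.length :=
    Primrec.nat_lt.comp (primrec_idxOf_coins.comp Primrec.snd (Primrec.snd.comp Primrec.fst))
      (Primrec.list_length.comp (Primrec.snd.comp Primrec.fst))
  have h : Primrec fun a : List (ℕ × Bool × ℕ) × List (ℕ × Bool × ℕ) =>
      a.1.flatMap fun e => if a.2.idxOf e < a.2.length then [] else [e] :=
    Primrec.list_flatMap Primrec.fst (Primrec.ite hm (Primrec.const [])
      (Primrec.list_cons.comp Primrec.snd (Primrec.const []))).to₂
  suffices h' : Primrec fun a : List (ℕ × Bool × ℕ) × List (ℕ × Bool × ℕ) =>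
      newEntries a.1 a.2 from h'.to₂
  refine h.of_eq ?_
  rintro ⟨G, G'⟩
  simp only [newEntries, List.idxOf_lt_length_iff]
  induction G with
  | nil => rfl
  | cons e G ih =>
    rw [List.flatMap_cons, ih, List.filter_cons]
    by_cases he : e ∈ G' <;> simp [he]

theorem primrec_lookupValues :
    Primrec fun a : (List (ℕ × Bool × ℕ) × List (ℕ × Bool × ℕ)) × List Bool × List Bool =>
      lookupValues a.1.1 a.1.2 a.2.1 a.2.2 := by
  have hH : Primrec fun a : (List (ℕ × Bool × ℕ) × List (ℕ × Bool × ℕ)) × List Bool × List Bool =>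
      a.1.2 ++ newEntries a.1.1 a.1.2 :=
    Primrec.list_append.comp (Primrec.snd.comp Primrec.fst) (primrec_newEntries.comp
      (Primrec.fst.comp Primrec.fst) (Primrec.snd.comp Primrec.fst))
  have hy : Primrec fun a : (List (ℕ × Bool × ℕ) × List (ℕ × Bool × ℕ)) × List Bool × List Bool =>
      a.2.2 ++ a.2.1 :=
    Primrec.list_append.comp (Primrec.snd.comp Primrec.snd) (Primrec.fst.comp Primrec.snd)
  exact Primrec.list_map (Primrec.fst.comp Primrec.fst)
    (Primrec.list_getI.comp (hy.comp Primrec.fst)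
      (primrec_idxOf_coins.comp Primrec.snd (hH.comp Primrec.fst))).to₂

theorem pair_lt_sq {a b X : ℕ} (ha : a < X) (hb : b < X) : Nat.pair a b < X ^ 2 :=
  (Nat.pair_lt_max_add_one_sq a b).trans_le (Nat.pow_le_pow_left (by omega) 2)

theorem encode_lt_of_mem_slopeCodes {m n : ℕ} {L : List (ℕ × ℕ)} (hL : L ∈ slopeCodes m n) :
    Encodable.encode L < (n + 2) ^ (2 * 3 ^ m) := by
  obtain ⟨c, rfl⟩ := hL
  induction m with
  | zero => simp
  | succ m ih =>
    beta_reduce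
    rw [List.ofFn_succ, Encodable.encode_list_cons]
    have h1 : Encodable.encode ((c 0).1.val, (c 0).2.val) < (n + 2) ^ (2 * 3 ^ m) := by
      refine (pair_lt_sq (X := n + 2) (by simp; omega) (by simp; omega)).trans_le
        (Nat.pow_le_pow_right (by omega) ?_)
      have := Nat.one_le_pow m 3 (by norm_num)
      omega
    have h2 := pair_lt_sq h1 (ih fun i => c i.succ)
    have h3 : 2 ≤ (n + 2) ^ (2 * 3 ^ m) := by
      calc 2 ≤ (n + 2) ^ 1 := by simp
        _ ≤ _ := Nat.pow_le_pow_right (by omega) (Nat.pos_of_ne_zero (by positivity))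
    calc _ < ((n + 2) ^ (2 * 3 ^ m)) ^ 2 + 1 := Nat.succ_lt_succ h2
      _ ≤ ((n + 2) ^ (2 * 3 ^ m)) ^ 3 := by nlinarith [sq_nonneg ((n + 2) ^ (2 * 3 ^ m))]
      _ = _ := by rw [← pow_mul]; ring_nf

/-- The two lists of slopes coded by a number. -/
def decodeSlopes (e : ℕ) : List (ℕ × ℕ) × List (ℕ × ℕ) := (Encodable.decode e).getD default

theorem primrec_decodeSlopes : Primrec decodeSlopes :=
  Primrec.option_getD_default.comp Primrec.decode

theorem decodeSlopes_encode (L L' : List (ℕ × ℕ)) :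
    decodeSlopes (Encodable.encode (L, L')) = (L, L') := by
  simp [decodeSlopes]

/-- The coins used up to the time given by the length of `y`, along the two lists of slopes coded
by `e`. -/
def codedCoins (m e : ℕ) (y : List Bool) : List (ℕ × Bool × ℕ) × List (ℕ × Bool × ℕ) :=
  (coinIndices m (fractionStair (decodeSlopes e).1) y.length,
    coinIndices m (fractionStair (decodeSlopes e).2) y.length)

theorem primrec_codedCoins (m : ℕ) : Primrec₂ (codedCoins m) := by
  have hd : Primrec fun a : ℕ × List Bool => decodeSlopes a.1 :=
    primrec_decodeSlopes.comp Primrec.fst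
  have hN : Primrec fun a : ℕ × List Bool => a.2.length :=
    Primrec.list_length.comp Primrec.snd
  have h1 : Primrec fun a : ℕ × List Bool => (decodeSlopes a.1).1 := Primrec.fst.comp hd
  have h2 : Primrec fun a : ℕ × List Bool => (decodeSlopes a.1).2 := Primrec.snd.comp hd
  have h := ((primrec_coinIndices m).comp h1 hN).pair ((primrec_coinIndices m).comp h2 hN)
  exact h.to₂

theorem codedCoins_encode (m : ℕ) (L L' : List (ℕ × ℕ)) (y : List Bool) :
    codedCoins m (Encodable.encode (L, L')) y =
      (coinIndices m (fractionStair L) y.length, coinIndices m (fractionStair L') y.length) := by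
  rw [codedCoins, decodeSlopes_encode]

/-- The values along one interleaving are described, given those along another one, by both lists
of slopes and the coins not used along the other one. -/
theorem IsOptimalPrefixMachine.exists_condK_coins_le_log_encode
    {U : List Bool → List Bool →. List Bool} (hU : IsOptimalPrefixMachine U) (m : ℕ) :
    ∃ c : ℕ, ∀ (n : ℕ) (L L' : List (ℕ × ℕ)), ∀ G G' : List (ℕ × Bool × ℕ),
      G = coinIndices m (fractionStair L) n → G' = coinIndices m (fractionStair L') n →
      G.Nodup → ∀ ω : ℕ × Bool × ℕ → Bool,
      condK U (G.map ω) (G'.map ω) ≤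
        (G.toFinset \ G'.toFinset).card + 2 * Nat.log 2 (Encodable.encode (L, L')) + c := by
  have hG : Primrec fun a : ℕ × List Bool × List Bool => codedCoins m a.1 a.2.2 :=
    (primrec_codedCoins m).comp Primrec.fst (Primrec.snd.comp Primrec.snd)
  have hlen : Primrec₂ fun (e : ℕ) (y : List Bool) =>
      (newEntries (codedCoins m e y).1 (codedCoins m e y).2).length :=
    Primrec.list_length.comp₂ (primrec_newEntries.comp₂ (Primrec.fst.comp₂ (primrec_codedCoins m))
      (Primrec.snd.comp₂ (primrec_codedCoins m)))
  obtain ⟨c, hc⟩ := hU.condK_le_of_primrec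
    (out := fun e z y => lookupValues (codedCoins m e y).1 (codedCoins m e y).2 z y)
    (primrec_lookupValues.comp (hG.pair Primrec.snd)) hlen
  refine ⟨c, ?_⟩
  rintro n L L' G G' hG rfl hnd ω
  have h := hc (Encodable.encode (L, L')) ((newEntries G (coinIndices m (fractionStair L') n)).map ω)
    ((coinIndices m (fractionStair L') n).map ω)
  simp only [codedCoins_encode, List.length_map, length_coinIndices] at h
  rw [← hG] at h
  simpa only [lookupValues_map, length_newEntries hnd, forall_const] using h

theorem log_encode_le_of_mem_slopeCodes {m n : ℕ} {L L' : List (ℕ × ℕ)} (hL : L ∈ slopeCodes m n)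
    (hL' : L' ∈ slopeCodes m n) :
    Nat.log 2 (Encodable.encode (L, L')) ≤ 2 * 3 ^ m * 2 * (Nat.log 2 (n + 2) + 1) := by
  have he : Encodable.encode (L, L') < (n + 2) ^ (2 * 3 ^ m * 2) := by
    rw [pow_mul]
    exact pair_lt_sq (encode_lt_of_mem_slopeCodes hL) (encode_lt_of_mem_slopeCodes hL')
  refine (Nat.log_mono_right (m := 2 ^ (2 * 3 ^ m * 2 * (Nat.log 2 (n + 2) + 1))) ?_).trans_eq
    (Nat.log_pow one_lt_two _)
  rw [mul_comm (2 * 3 ^ m * 2) (_ + 1), pow_mul 2]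
  refine he.le.trans ?_
  exact Nat.pow_le_pow_left (Nat.lt_pow_succ_log_self one_lt_two _).le _

/-! ### The lower bound -/

/-- The distribution of independent fair coins indexed by `ι`. -/
noncomputable def coinMeasure (ι : Type*) : Measure (ι → Bool) :=
  Measure.infinitePi fun _ => (PMF.uniformOfFintype Bool).toMeasure

instance (ι : Type*) : IsProbabilityMeasure (coinMeasure ι) := by
  unfold coinMeasure
  infer_instance

theorem coinMeasure_eqOn (ι : Type*) (S : Finset ι) (ω₀ : ι → Bool) :
    coinMeasure ι {ω | ∀ e ∈ S, ω e = ω₀ e} = 2⁻¹ ^ S.card := by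
  have h : {ω : ι → Bool | ∀ e ∈ S, ω e = ω₀ e} = Set.pi S fun e => {ω₀ e} := by
    ext ω
    simp [Set.mem_pi]
  rw [h, coinMeasure, Measure.infinitePi_pi _ (fun _ _ => MeasurableSet.singleton _)]
  simp

/-- For random coins, the values along `G` cannot be compressed, given those along `G'`, by more
than `t` bits below the number of new coins, except with probability `2⁻ᵗ`. This is a count of
programs, for which the machine need not be computable. -/
theorem coinMeasure_compressible_le {ι : Type*} [DecidableEq ι]
    (U : List Bool → List Bool →. List Bool) (t : ℕ) (G G' : List ι) :
    coinMeasure ι {ω | ∃ q : List Bool, q.length + t < (G.toFinset \ G'.toFinset).card ∧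
      G.map ω ∈ U q (G'.map ω)} ≤ 2⁻¹ ^ t := by
  set S := G.toFinset
  set S' := G'.toFinset
  set k := (S \ S').card
  -- A program and the coins along `G'` determine the coins along `G`.
  let A : (Σ l : Fin (k - t), Fin l → Bool) × (S' → Bool) → Set (ι → Bool) := fun i =>
    {ω | (∀ e : S', ω e = i.2 e) ∧ G.map ω ∈ U (List.ofFn i.1.2) (G'.map ω)}
  have hA : ∀ i, coinMeasure ι (A i) ≤ 2⁻¹ ^ (S'.card + k) := by
    intro i
    rcases (A i).eq_empty_or_nonempty with h | ⟨ω₀, h0, h0'⟩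
    · simp [h]
    · have hcard : (S' ∪ S).card = S'.card + k := by
        rw [← Finset.union_sdiff_self_eq_union,
          Finset.card_union_of_disjoint Finset.disjoint_sdiff]
      rw [← hcard, ← coinMeasure_eqOn ι (S' ∪ S) ω₀]
      refine measure_mono ?_
      rintro ω ⟨h1, h1'⟩
      have hG' : ∀ e ∈ G', ω e = ω₀ e := fun e he => by
        have := h1 ⟨e, List.mem_toFinset.2 he⟩
        rw [this, ← h0 ⟨e, List.mem_toFinset.2 he⟩]
      rw [List.map_congr_left hG'] at h1'
      have hG : G.map ω = G.map ω₀ := Part.mem_unique h1' h0'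
      intro e he
      rcases Finset.mem_union.1 he with he | he
      · exact hG' e (List.mem_toFinset.1 he)
      · exact List.map_inj_left.1 hG e (List.mem_toFinset.1 he)
  rcases le_total k t with hkt | hkt
  · rw [show {ω : ι → Bool | ∃ q : List Bool, q.length + t < k ∧ G.map ω ∈ U q (G'.map ω)} = ∅ by
      ext ω
      simp only [Set.mem_ofPred_eq, Set.mem_empty_iff_false, iff_false]
      rintro ⟨q, hq, -⟩
      omega]
    simp
  have hcount : Fintype.card ((Σ l : Fin (k - t), Fin l → Bool) × (S' → Bool)) ≤
      2 ^ (k - t) * 2 ^ S'.card := by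
    rw [Fintype.card_prod, Fintype.card_sigma]
    simp only [Fintype.card_fun, Fintype.card_bool, Fintype.card_fin, Fintype.card_coe]
    rw [Fin.sum_univ_eq_sum_range fun l => 2 ^ l]
    exact Nat.mul_le_mul_right _ (Nat.geomSum_lt le_rfl (by simp)).le
  calc _ ≤ coinMeasure ι (⋃ i, A i) := by
        refine measure_mono ?_
        rintro ω ⟨q, hq, hU⟩
        refine Set.mem_iUnion.2 ⟨⟨⟨⟨q.length, by omega⟩, fun j => q.get j⟩, fun e => ω e⟩,
          fun e => rfl, ?_⟩
        simpa using hU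
    _ ≤ ∑ i, coinMeasure ι (A i) := measure_iUnion_fintype_le _ _
    _ ≤ ∑ i : (Σ l : Fin (k - t), Fin l → Bool) × (S' → Bool), 2⁻¹ ^ (S'.card + k) :=
        Finset.sum_le_sum fun i _ => hA i
    _ ≤ (2 ^ (k - t) * 2 ^ S'.card : ℕ) * 2⁻¹ ^ (S'.card + k) := by
        rw [Finset.sum_const, nsmul_eq_mul, Finset.card_univ]
        gcongr
    _ = 2⁻¹ ^ t := by
        have h2 : ∀ j : ℕ, (2 : ℝ≥0∞) ^ j * 2⁻¹ ^ j = 1 := fun j => by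
          rw [← mul_pow, ENNReal.mul_inv_cancel (by simp) (by simp), one_pow]
        have hk : S'.card + k = (k - t) + S'.card + t := by omega
        rw [hk, pow_add, pow_add]
        push_cast
        calc _ = ((2 : ℝ≥0∞) ^ (k - t) * 2⁻¹ ^ (k - t)) * (2 ^ S'.card * 2⁻¹ ^ S'.card) * 2⁻¹ ^ t := by ring
          _ = _ := by rw [h2, h2, one_mul, one_mul]

theorem ncard_slopeCodes_le (m n : ℕ) : (slopeCodes m n).ncard ≤ (n + 1) ^ (2 * m) := by
  unfold slopeCodes
  rw [← Set.image_univ]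
  refine (Set.ncard_image_le Set.finite_univ).trans ?_
  rw [Set.ncard_univ, Nat.card_eq_fintype_card]
  simp [← pow_two, ← pow_mul]

theorem finite_slopeCodes (m n : ℕ) : (slopeCodes m n).Finite := Set.finite_range _

/-- Almost surely, there are only finitely many horizons `n` at which some interleaving has
conditional complexity below the number of new coins by more than a multiple of `log n`. -/
theorem ae_eventually_coins_incompressible (U : List Bool → List Bool →. List Bool) (m : ℕ) :
    ∀ᵐ ω ∂coinMeasure (ℕ × Bool × ℕ), ∀ᶠ n : ℕ in Filter.atTop,
      ∀ L ∈ slopeCodes m n, ∀ L' ∈ slopeCodes m n, ∀ G G' : List (ℕ × Bool × ℕ),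
      G = coinIndices m (fractionStair L) (m * n) → G' = coinIndices m (fractionStair L') (m * n) →
      ∀ q, G.map ω ∈ U q (G'.map ω) →
        (G.toFinset \ G'.toFinset).card ≤ q.length + (4 * m + 2) * (Nat.log 2 (n + 1) + 1) := by
  let E : ℕ → List (ℕ × ℕ) → List (ℕ × ℕ) → Set (ℕ × Bool × ℕ → Bool) := fun n L L' =>
    {ω | ∃ q : List Bool, q.length + (4 * m + 2) * (Nat.log 2 (n + 1) + 1) <
      ((coinIndices m (fractionStair L) (m * n)).toFinset \
        (coinIndices m (fractionStair L') (m * n)).toFinset).card ∧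
      (coinIndices m (fractionStair L) (m * n)).map ω ∈
        U q ((coinIndices m (fractionStair L') (m * n)).map ω)}
  let B : ℕ → Set (ℕ × Bool × ℕ → Bool) := fun n =>
    ⋃ L ∈ (finite_slopeCodes m n).toFinset, ⋃ L' ∈ (finite_slopeCodes m n).toFinset, E n L L'
  have hB : ∀ n : ℕ, coinMeasure _ (B n) ≤ ENNReal.ofReal (1 / ((n : ℝ) + 1) ^ 2) := by
    intro n
    have hc : (finite_slopeCodes m n).toFinset.card ≤ (n + 1) ^ (2 * m) := by
      rw [← Set.ncard_eq_toFinset_card _ (finite_slopeCodes m n)]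
      exact ncard_slopeCodes_le m n
    have hX : ((2⁻¹ : ℝ≥0∞)) ^ (Nat.log 2 (n + 1) + 1) ≤ ((n + 1 : ℕ) : ℝ≥0∞)⁻¹ := by
      rw [← ENNReal.inv_pow, ENNReal.inv_le_inv]
      exact_mod_cast (Nat.lt_pow_succ_log_self one_lt_two (n + 1)).le
    have h1 : ((n + 1 : ℕ) : ℝ≥0∞) * ((n + 1 : ℕ) : ℝ≥0∞)⁻¹ = 1 :=
      ENNReal.mul_inv_cancel (by simp) (by simp)
    calc coinMeasure _ (B n)
        ≤ ∑ L ∈ (finite_slopeCodes m n).toFinset, ∑ L' ∈ (finite_slopeCodes m n).toFinset,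
            coinMeasure _ (E n L L') :=
          (measure_biUnion_finset_le _ _).trans
            (Finset.sum_le_sum fun L _ => measure_biUnion_finset_le _ _)
      _ ≤ ∑ L ∈ (finite_slopeCodes m n).toFinset, ∑ L' ∈ (finite_slopeCodes m n).toFinset,
            (((n + 1 : ℕ) : ℝ≥0∞)⁻¹) ^ (4 * m + 2) := by
          refine Finset.sum_le_sum fun L _ => Finset.sum_le_sum fun L' _ => ?_
          -- `4 m` factors outweigh the number of pairs of codes, two make the sum over `n` finite.
          refine (coinMeasure_compressible_le U _ _ _).trans ?_
          rw [mul_comm, pow_mul]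
          gcongr
      _ = ((finite_slopeCodes m n).toFinset.card * (finite_slopeCodes m n).toFinset.card : ℕ) *
            (((n + 1 : ℕ) : ℝ≥0∞)⁻¹) ^ (4 * m + 2) := by
          simp only [Finset.sum_const, nsmul_eq_mul]
          push_cast
          ring
      _ ≤ ((n + 1) ^ (2 * m) * (n + 1) ^ (2 * m) : ℕ) * (((n + 1 : ℕ) : ℝ≥0∞)⁻¹) ^ (4 * m + 2) := by
          gcongr
      _ = (((n + 1 : ℕ) : ℝ≥0∞) * ((n + 1 : ℕ) : ℝ≥0∞)⁻¹) ^ (4 * m) *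
            (((n + 1 : ℕ) : ℝ≥0∞)⁻¹) ^ 2 := by
          have h2 : ∀ x y : ℝ≥0∞,
              x ^ (2 * m) * x ^ (2 * m) * y ^ (4 * m + 2) = (x * y) ^ (4 * m) * y ^ 2 := by
            intro x y
            ring
          rw [← h2]
          push_cast
          rfl
      _ = ENNReal.ofReal (1 / ((n : ℝ) + 1) ^ 2) := by
          rw [h1, one_pow, one_mul, one_div, ENNReal.ofReal_inv_of_pos (by positivity),
            ENNReal.ofReal_pow (by positivity), ENNReal.inv_pow]
          norm_cast
  have hsum : ∑' n, coinMeasure _ (B n) ≠ ∞ := by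
    refine ne_top_of_le_ne_top ?_ (ENNReal.tsum_le_tsum hB)
    refine Summable.tsum_ofReal_ne_top ?_
    have := (summable_nat_add_iff 1).2 (Real.summable_one_div_nat_pow.2 one_lt_two)
    simpa using this
  filter_upwards [ae_eventually_notMem hsum] with ω hω
  filter_upwards [hω] with n hn
  rintro L hL L' hL' G G' rfl rfl q hq
  by_contra! hlt
  refine hn ?_
  simp only [B, Set.mem_iUnion, Set.Finite.mem_toFinset]
  exact ⟨L, hL, L', hL', q, hlt, hq⟩

/-! ### The embeddings -/

/-- For suitable coins, the conditional complexity of two interleavings is the number of coins used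
by one and not by the other, up to a logarithmic error. -/
theorem IsOptimalPrefixMachine.exists_coins {U : List Bool → List Bool →. List Bool}
    (hU : IsOptimalPrefixMachine U) (m : ℕ) :
    ∃ (ω : ℕ × Bool × ℕ → Bool) (a b : ℕ), ∀ n : ℕ, 1 ≤ n → ∀ w w' : ℕ → ℝ,
      (∀ i, 0 ≤ w i ∧ w i ≤ 1) → (∀ i, 0 ≤ w' i ∧ w' i ≤ 1) → ∀ G G' : List (ℕ × Bool × ℕ),
      G = coinIndices m (slopeStair w) (m * n) → G' = coinIndices m (slopeStair w') (m * n) →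
      condK U (G.map ω) (G'.map ω) ≤ (G.toFinset \ G'.toFinset).card + (a * Nat.log 2 n + b) ∧
        (G.toFinset \ G'.toFinset).card ≤ condK U (G.map ω) (G'.map ω) + (a * Nat.log 2 n + b) := by
  obtain ⟨ω, hω⟩ := (ae_eventually_coins_incompressible U m).exists
  obtain ⟨N, hN⟩ := Filter.eventually_atTop.1 hω
  obtain ⟨c, hc⟩ := hU.exists_condK_coins_le_log_encode m
  refine ⟨ω, 2 * (2 * 3 ^ m * 2) + (4 * m + 2),
    2 * (2 * 3 ^ m * 2) * 3 + (4 * m + 2) * 3 + c + m * N, ?_⟩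
  rintro n hn w w' hw hw' G G' hG hG'
  obtain ⟨L, hL, hLG⟩ := exists_slopeCode (m := m) (fun i => (hw i).1) (fun i => (hw i).2) hn
  obtain ⟨L', hL', hLG'⟩ := exists_slopeCode (m := m) (fun i => (hw' i).1) (fun i => (hw' i).2) hn
  have hlog : ∀ j : ℕ, j ≤ 4 * n → Nat.log 2 j ≤ Nat.log 2 n + 2 := by
    intro j hj
    refine (Nat.log_mono_right hj).trans_eq ?_
    rw [show 4 * n = n * 2 * 2 by ring, Nat.log_mul_base one_lt_two (by omega),
      Nat.log_mul_base one_lt_two (by omega)]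
  constructor
  · have h1 := hc (m * n) L L' G G' (hG.trans hLG.symm) (hG'.trans hLG'.symm)
      (by rw [hG]; exact nodup_coinIndices fun i _ => isStaircase_slopeStair (hw i).1 (hw i).2) ω
    have h2 := log_encode_le_of_mem_slopeCodes hL hL'
    have h3 := Nat.mul_le_mul_left (2 * 3 ^ m * 2) (Nat.succ_le_succ (hlog (n + 2) (by omega)))
    generalize 2 * 3 ^ m * 2 = d at *
    have h4 : d * (Nat.log 2 n + 2).succ = d * Nat.log 2 n + 3 * d := by
      rw [Nat.succ_eq_add_one]
      ring
    have h5 : (2 * d + (4 * m + 2)) * Nat.log 2 n =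
        2 * (d * Nat.log 2 n) + (4 * m + 2) * Nat.log 2 n := by ring
    have h6 : d * (Nat.log 2 (n + 2) + 1) ≤ d * Nat.log 2 n + 3 * d := by rw [← h4]; exact h3
    rw [h5]
    omega
  · rcases lt_or_ge n N with hnN | hnN
    -- For the finitely many exceptional `n` the number of coins is bounded.
    · have h1 : (G.toFinset \ G'.toFinset).card ≤ m * N := by
        refine (Finset.card_le_card Finset.sdiff_subset).trans
          ((List.toFinset_card_le _).trans ?_)
        rw [hG, length_coinIndices]
        exact Nat.mul_le_mul_left _ hnN.le
      omega
    · obtain ⟨q, hq, hql⟩ := hU.exists_program (G.map ω) (G'.map ω)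
      have h1 := hN n hnN L hL L' hL' G G' (hG.trans hLG.symm) (hG'.trans hLG'.symm) q hq
      have h3 := Nat.mul_le_mul_left (4 * m + 2) (Nat.succ_le_succ (hlog (n + 1) (by omega)))
      generalize 2 * 3 ^ m * 2 = d at *
      generalize 4 * m + 2 = d' at *
      have h4 : d' * (Nat.log 2 n + 2).succ = d' * Nat.log 2 n + d' * 3 := by
        rw [Nat.succ_eq_add_one]
        ring
      have h5 : (2 * d + d') * Nat.log 2 n = 2 * (d * Nat.log 2 n) + d' * Nat.log 2 n := by ring
      have h6 : d' * (Nat.log 2 (n + 1) + 1) ≤ d' * Nat.log 2 n + d' * 3 := by rw [← h4]; exact h3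
      rw [h5]
      omega

/-- The number of coins used along slopes `w` and not along slopes `w'` is the scaled distance of
the slopes, up to a constant. -/
theorem abs_card_coinIndices_sdiff_sub_le {m n : ℕ} {w w' : ℕ → ℝ}
    (hw : ∀ i, 0 ≤ w i ∧ w i ≤ 1) (hw' : ∀ i, 0 ≤ w' i ∧ w' i ≤ 1) :
    abs ((((coinIndices m (slopeStair w) (m * n)).toFinset \
        (coinIndices m (slopeStair w') (m * n)).toFinset).card : ℝ) -
      n * ∑ i ∈ Finset.range m, |w i - w' i|) ≤ m := by
  rw [card_coinIndices_sdiff (fun i _ => isStaircase_slopeStair (hw i).1 (hw i).2)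
    fun i _ => isStaircase_slopeStair (hw' i).1 (hw' i).2, Finset.mul_sum, Nat.cast_sum,
    ← Finset.sum_sub_distrib]
  refine (Finset.abs_sum_le_sum_abs _ _).trans ?_
  calc _ ≤ ∑ i ∈ Finset.range m, (1 : ℝ) := by
        refine Finset.sum_le_sum fun i _ => ?_
        have h := abs_floor_sub_floor_sub_le (mul_nonneg (hw i).1 n.cast_nonneg)
          (mul_nonneg (hw' i).1 n.cast_nonneg)
        rwa [← sub_mul, abs_mul, abs_of_nonneg (n.cast_nonneg : (0 : ℝ) ≤ n), mul_comm |_|] at h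
    _ = m := by simp

/-- The unit cube with the scaled `ℓ¹`-distance is realized by interleavings of suitable coins. -/
theorem IsOptimalPrefixMachine.exists_coins_abs_complexityDist_le
    {U : List Bool → List Bool →. List Bool} (hU : IsOptimalPrefixMachine U) {c : ℝ} (hc : 0 ≤ c)
    (m : ℕ) :
    ∃ (ω : ℕ × Bool × ℕ → Bool) (a b : ℝ), ∀ n : ℕ, 1 ≤ n → ∀ w w' : ℕ → ℝ,
      (∀ i, 0 ≤ w i ∧ w i ≤ 1) → (∀ i, 0 ≤ w' i ∧ w' i ≤ 1) →
      abs (complexityDist U c ((coinIndices m (slopeStair w) (m * n)).map ω)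
        ((coinIndices m (slopeStair w') (m * n)).map ω) -
          n * ∑ i ∈ Finset.range m, |w i - w' i|) ≤ a * Real.logb 2 n + b := by
  obtain ⟨ω, a, b, h⟩ := hU.exists_coins m
  obtain ⟨c₀, hc₀⟩ := hU.condK_self_le
  refine ⟨ω, a, b + c₀ + c + m, fun n hn w w' hw hw' => ?_⟩
  obtain ⟨h1, h2⟩ := h n hn w w' hw hw' _ _ rfl rfl
  obtain ⟨h3, h4⟩ := h n hn w' w hw' hw _ _ rfl rfl
  have h5 := abs_le.1 (abs_card_coinIndices_sdiff_sub_le (m := m) (n := n) hw hw')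
  have h6 := abs_le.1 (abs_card_coinIndices_sdiff_sub_le (m := m) (n := n) hw' hw)
  simp only [abs_sub_comm (w' _) (w _)] at h6
  have hlog : (a : ℝ) * Nat.log 2 n ≤ a * Real.logb 2 n :=
    mul_le_mul_of_nonneg_left (by exact_mod_cast Real.natLog_le_logb n 2) a.cast_nonneg
  generalize hx : (coinIndices m (slopeStair w) (m * n)).map ω = x at *
  generalize hx' : (coinIndices m (slopeStair w') (m * n)).map ω = x' at *
  have h1' := (Nat.cast_le (α := ℝ)).2 h1
  have h2' := (Nat.cast_le (α := ℝ)).2 h2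
  have h3' := (Nat.cast_le (α := ℝ)).2 h3
  have h4' := (Nat.cast_le (α := ℝ)).2 h4
  push_cast at h1' h2' h3' h4'
  have hc0 : (0 : ℝ) ≤ c₀ := c₀.cast_nonneg
  have hS : 0 ≤ n * ∑ i ∈ Finset.range m, |w i - w' i| :=
    mul_nonneg n.cast_nonneg (Finset.sum_nonneg fun _ _ => abs_nonneg _)
  unfold complexityDist
  split_ifs with heq
  · subst heq
    have h7 := (Nat.cast_le (α := ℝ)).2 (hc₀ x)
    rw [abs_le]
    constructor <;> linarith
  · rw [abs_le]
    constructor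
    · have := le_max_left (condK U x x' : ℝ) (condK U x' x)
      linarith
    · have : max (condK U x x' : ℝ) (condK U x' x) ≤
          n * ∑ i ∈ Finset.range m, |w i - w' i| + m + (a * Real.logb 2 n + b) :=
        max_le (by linarith) (by linarith)
      linarith

theorem mainTheorem3 (U : List Bool → List Bool →. List Bool) (hU : IsOptimalPrefixMachine U)
    (c : ℝ) (hc : 0 ≤ c) (m : ℕ) (V : Set (PiLp 1 fun _ : Fin m => ℝ))
    (hV : Bornology.IsBounded V) :
    (∃ φ : ℕ → V → List Bool, IsStringEmbedding (complexityDist U c) φ) ∧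
      (∃ φ : V → ℕ → Bool, IsSequenceEmbedding (complexityDist U c) φ) := by
  -- The prefixes of a sequence-embedding form a string-embedding.
  suffices h : ∃ φ : V → ℕ → Bool, IsSequenceEmbedding (complexityDist U c) φ by
    obtain ⟨φ, f, hmono, hpoly, hf⟩ := h
    exact ⟨⟨_, hf⟩, φ, f, hmono, hpoly, hf⟩
  obtain ⟨ω, a, b, h⟩ := hU.exists_coins_abs_complexityDist_le hc m
  obtain ⟨C, hC⟩ := hV.exists_norm_le
  obtain ⟨R, hR⟩ := exists_nat_ge (max C 1)
  have hR1 : (1 : ℝ) ≤ R := (le_max_right _ _).trans hR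
  have hR0 : 1 ≤ R := by exact_mod_cast hR1
  -- The affine map of the cube `[-R, R] ^ m` onto the unit cube.
  let w : V → ℕ → ℝ := fun v i => if hi : i < m then (v.1 ⟨i, hi⟩ + R) / (2 * R) else 0
  have hw : ∀ v i, 0 ≤ w v i ∧ w v i ≤ 1 := by
    intro v i
    by_cases hi : i < m
    · have h1 : |v.1 ⟨i, hi⟩| ≤ R := by
        rw [← Real.norm_eq_abs]
        exact (PiLp.norm_apply_le v.1 _).trans ((hC _ v.2).trans ((le_max_left _ _).trans hR))
      rw [abs_le] at h1
      simp only [w, dif_pos hi]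
      constructor
      · exact div_nonneg (by linarith) (by linarith)
      · rw [div_le_one (by linarith)]
        linarith
    · simp [w, hi]
  have hdist : ∀ v v' : V, ∀ s : ℕ, ((2 * R * s : ℕ) : ℝ) *
      ∑ i ∈ Finset.range m, |w v i - w v' i| = s * dist v v' := by
    intro v v' s
    rw [Subtype.dist_eq, PiLp.dist_eq_of_L1, Finset.sum_range, Finset.mul_sum, Finset.mul_sum]
    refine Finset.sum_congr rfl fun i _ => ?_
    have hR2 : (0 : ℝ) < 2 * R := by linarith
    simp only [w, dif_pos i.2, Fin.eta, Real.dist_eq]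
    rw [← sub_div, abs_div, abs_of_pos hR2, add_sub_add_right_eq_sub]
    push_cast
    field_simp
  refine ⟨fun v t => ω (coinIndex m (slopeStair (w v)) t), fun s _ => m * (2 * R * s), ?_,
    ⟨m * (2 * R), 1, fun s _ v => by rw [pow_one, mul_assoc]⟩,
    a, a * Real.logb 2 ((2 * R : ℕ) : ℝ) + b, fun s hs v v' => ?_⟩
  · exact fun v s s' hss => Nat.mul_le_mul_left _ (Nat.mul_le_mul_left _ hss)
  · have hseg : ∀ v, initialSegment (fun t => ω (coinIndex m (slopeStair (w v)) t))
        (m * (2 * R * s)) = (coinIndices m (slopeStair (w v)) (m * (2 * R * s))).map ω := by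
      intro v
      rw [initialSegment, coinIndices, List.map_map]
      rfl
    have h1 := h (2 * R * s) (Nat.mul_pos (by omega) hs) (w v) (w v') (hw v) (hw v')
    rw [hdist] at h1
    beta_reduce
    rw [hseg, hseg]
    refine h1.trans_eq ?_
    rw [Nat.cast_mul (2 * R) s, Real.logb_mul (by positivity) (by positivity)]
    ring
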